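/- Let $F$ be $\mathbb{R}$ or $\mathbb{C}$. For a finite simple graph $H$ with vertex set $V$, let $\operatorname{msr}(H)$ (the minimum semidefinite rank of $H$ over $F$) be the smallest rank of a positive semidefinite matrix $A=(a_{ij})_{i,j\in V}$ (real symmetric if $F=\mathbb{R}$, complex Hermitian if $F=\mathbb{C}$) such that for all $i\neq j$ one has $a_{ij}\neq 0$ if and only if $i$ and $j$ are adjacent in $H$; the diagonal entries are not constrained by $H$. A cactus graph is a connected simple graph in which every edge is part of at most one cycle. Let $G$ be a finite cactus graph with at least two cycles, and let $\overline{G}$ be its complement. Then $G$ satisfies $\mathrm{GCC}_+$, that is, $$\operatorname{msr}(G)+\operatorname{msr}(\overline{G})\le |G|+2 .$$ -/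

import Mathlib

open scoped ComplexOrder

namespace SimpleGraph

variable {V : Type*}

/-- A subgraph of `G` is a cycle of `G` when it consists of the vertices and edges of some closed
walk of length at least three without repeated vertices (except that the end is the start). -/
def IsCycleSubgraph {G : SimpleGraph V} (C : G.Subgraph) : Prop :=
  ∃ (u : V) (p : G.Walk u u), p.IsCycle ∧ p.toSubgraph = C

/-- A cactus graph: a connected simple graph in which every edge is part of at most one cycle
(cycles are compared as subgraphs). -/
def IsCactus (G : SimpleGraph V) : Prop :=
  G.Connected ∧
    ∀ e ∈ G.edgeSet, {C : G.Subgraph | IsCycleSubgraph C ∧ e ∈ C.edgeSet}.Subsingleton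

/-- The graph `G` has at least two (distinct) cycles. -/
def HasTwoCycles (G : SimpleGraph V) : Prop :=
  {C : G.Subgraph | IsCycleSubgraph C}.Nontrivial

/-- The positive semidefinite matrices (real symmetric for `𝕜 = ℝ`, complex Hermitian for `𝕜 = ℂ`)
whose graph is `G`: the off-diagonal entry at `(i, j)` is nonzero exactly when `i` and `j` are
adjacent; the diagonal is not constrained by `G`. -/
def psdMatrices (𝕜 : Type*) [RCLike 𝕜] (G : SimpleGraph V) : Set (Matrix V V 𝕜) :=
  {A | A.PosSemidef ∧ ∀ i j, i ≠ j → (A i j ≠ 0 ↔ G.Adj i j)}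

/-- The minimum semidefinite rank of `G` over `𝕜`. -/
noncomputable def msr (𝕜 : Type*) [RCLike 𝕜] [Fintype V] (G : SimpleGraph V) : ℕ :=
  sInf (Matrix.rank '' psdMatrices 𝕜 G)

/-- Every finite graph is the graph of some positive semidefinite matrix, so that the infimum
defining `msr` is over a nonempty set and is attained. -/
theorem psdMatrices_nonempty (𝕜 : Type*) [RCLike 𝕜] [Fintype V] (G : SimpleGraph V) :
    (psdMatrices 𝕜 G).Nonempty := by
  classical
  refine ⟨G.incMatrix 𝕜 * (G.incMatrix 𝕜).conjTranspose,
    Matrix.posSemidef_self_mul_conjTranspose _, ?_⟩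
  have h : (G.incMatrix 𝕜).conjTranspose = (G.incMatrix 𝕜).transpose := by
    ext i j
    simp only [Matrix.conjTranspose_apply, Matrix.transpose_apply, incMatrix_apply']
    split_ifs <;> simp
  intro i j hij
  rw [h, incMatrix_mul_transpose]
  simp [hij]

/-- The inequality of the Graph Complement Conjecture for the minimum semidefinite rank over `𝕜`,
for the graph `G`. -/
def SatisfiesGCCPlus (𝕜 : Type*) [RCLike 𝕜] [Fintype V] (G : SimpleGraph V) : Prop :=
  msr 𝕜 G + msr 𝕜 Gᶜ ≤ Fintype.card V + 2

end SimpleGraph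

/-! ### Orthogonal representations of degenerate graphs -/

namespace Submodule

/-! The bound splits as (n - 3) + 5 with n = |G|.

Complement: a longest-path argument shows that a cactus is 2-degenerate, and a k-degenerate graph
has vectors in dimension 2k + 1 that are orthogonal exactly along its edges. Their Gram matrix has
the complement as its graph; for k = 2 its rank is at most 5 (`IsDegenerate.msr_compl_le`).

Graph: removing one edge from each of two cycles leaves a connected graph, whose Laplacian has rank
at most n - 1. Each removed edge st is restored by subtracting the largest multiple of b bᵀ, b = e_s
- e_t, that positive semidefiniteness allows, and this lowers the rank
(`exists_mem_psdMatrices_sup_edge`). It requires b to be orthogonal to the kernel. After the first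
restoration the kernel also contains the potential of a unit current between the ends of the first
edge. This potential is constant on the second cycle, whose remaining edges are bridges not
separating those ends (`eq_of_lapMatrix_mulVec_eq`). -/

theorem exists_mem_forall_notMem {K E ι : Type*} [DivisionRing K] [Infinite K] [AddCommGroup E]
    [Module K E] [Finite ι] (W : Submodule K E) (p : ι → Submodule K E) (h : ∀ i, ¬ W ≤ p i) :
    ∃ w ∈ W, ∀ i, w ∉ p i := by
  by_contra! hc
  have hcov : ⋃ i, ((p i).comap W.subtype : Set W) = Set.univ := by
    refine Set.eq_univ_of_forall fun w => ?_
    obtain ⟨i, hi⟩ := hc w w.2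
    exact Set.mem_iUnion.2 ⟨i, hi⟩
  obtain ⟨i, hi⟩ := Subspace.exists_eq_top_of_iUnion_eq_univ hcov
  refine h i fun w hw => ?_
  have : (⟨w, hw⟩ : W) ∈ (p i).comap W.subtype := hi ▸ mem_top
  exact this

end Submodule

namespace SimpleGraph

variable {V : Type*}

open Classical in
/-- Every nonempty finite set of vertices contains a vertex with at most `k` neighbours in it. -/
def IsDegenerate (G : SimpleGraph V) (k : ℕ) : Prop :=
  ∀ S : Finset V, S.Nonempty → ∃ v ∈ S, (S.filter (G.Adj v)).card ≤ k

-- Vertices are added one at a time. The independence clause strengthens the induction: it keeps a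
-- non-neighbour from being forced orthogonal to the new vector. Orthogonality to at most k
-- neighbours leaves dimension at least k + 1, hence the 2k + 1.
open Module InnerProductSpace in
theorem IsDegenerate.exists_orthogonal_representation {𝕜 : Type*} [RCLike 𝕜] {E : Type*}
    [NormedAddCommGroup E] [InnerProductSpace 𝕜 E] [FiniteDimensional 𝕜 E]
    {G : SimpleGraph V} {k : ℕ} (hG : G.IsDegenerate k) (hE : 2 * k + 1 ≤ finrank 𝕜 E)
    (S : Finset V) :
    ∃ x : V → E, (∀ u ∈ S, ∀ v ∈ S, u ≠ v → (⟪x u, x v⟫_𝕜 = 0 ↔ G.Adj u v)) ∧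
      ∀ T ⊆ S, T.card ≤ k + 1 → LinearIndepOn 𝕜 x (T : Set V) := by
  classical
  induction hn : S.card generalizing S with
  | zero =>
    obtain rfl := Finset.card_eq_zero.1 hn
    exact ⟨0, by simp, fun T hT _ => by simp [Finset.subset_empty.1 hT]⟩
  | succ n ih =>
    obtain ⟨v, hv, hdeg⟩ := hG S (Finset.card_pos.1 (by omega))
    obtain ⟨x, hx, hind⟩ := ih (S.erase v) (by rw [Finset.card_erase_of_mem hv]; omega)
    set N := S.filter (G.Adj v) with hN
    have hNS : N ⊆ S.erase v := fun u hu => by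
      simp only [hN, Finset.mem_filter] at hu
      exact Finset.mem_erase.2 ⟨hu.2.ne', hu.1⟩
    have hdim (T : Finset V) : finrank 𝕜 (Submodule.span 𝕜 (x '' T)) ≤ T.card := by
      rw [← Finset.coe_image]
      exact (finrank_span_finset_le_card _).trans Finset.card_image_le
    set U := Submodule.span 𝕜 (x '' N) with hU
    have hW : k + 1 ≤ finrank 𝕜 Uᗮ := by
      have := U.finrank_add_finrank_orthogonal
      have : finrank 𝕜 U ≤ N.card := hdim N
      omega
    -- The subspaces to avoid: spans of at most k vectors, to keep independence, and the orthogonal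
    -- complements of the non-neighbours.
    let p : {T : Finset V // T ⊆ S ∧ T.card ≤ k} ⊕ {u // u ∈ S.erase v ∧ u ∉ N} →
        Submodule 𝕜 E :=
      Sum.elim (fun T => Submodule.span 𝕜 (x '' T)) (fun u => (𝕜 ∙ x u)ᗮ)
    have : Finite {T : Finset V // T ⊆ S ∧ T.card ≤ k} :=
      Set.Finite.subset (S.powerset.finite_toSet) fun T hT => by simpa using hT.1
    have : Finite {u // u ∈ S.erase v ∧ u ∉ N} :=
      Set.Finite.subset (S.finite_toSet) fun u hu => Finset.mem_of_mem_erase hu.1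
    obtain ⟨w, hwW, hwp⟩ := Uᗮ.exists_mem_forall_notMem p <| by
      rintro (⟨T, hTS, hT⟩ | ⟨u, hu, huN⟩) hle
      · have := Submodule.finrank_mono hle
        have : finrank 𝕜 (p (Sum.inl ⟨T, hTS, hT⟩)) ≤ T.card := hdim T
        omega
      · have h1 : x u ∈ U := by
          have h2 := Submodule.orthogonal_le hle
          rw [Submodule.orthogonal_orthogonal] at h2
          simp only [p, Sum.elim_inr, Submodule.orthogonal_orthogonal] at h2
          exact h2 (Submodule.mem_span_singleton_self _)
        have h3 := hind (insert u N) (Finset.insert_subset hu hNS)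
          (by rw [Finset.card_insert_of_notMem huN]; omega)
        rw [Finset.coe_insert, linearIndepOn_insert (by simpa using huN)] at h3
        exact h3.2 h1
    have hwT (T : Finset V) (hT : T ⊆ S) (hc : T.card ≤ k) : w ∉ Submodule.span 𝕜 (x '' T) :=
      hwp (Sum.inl ⟨T, hT, hc⟩)
    have hadj (u) (hu : u ∈ S.erase v) : ⟪x u, w⟫_𝕜 = 0 ↔ G.Adj v u := by
      constructor
      · intro h
        by_contra hna
        refine hwp (Sum.inr ⟨u, hu, fun h => hna (Finset.mem_filter.1 h).2⟩) ?_
        exact Submodule.mem_orthogonal_singleton_iff_inner_right.2 h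
      · intro h
        refine (Submodule.mem_orthogonal _ _).1 hwW _ (Submodule.subset_span ⟨u, ?_, rfl⟩)
        exact Finset.mem_filter.2 ⟨Finset.mem_of_mem_erase hu, h⟩
    have hxu (u) (hu : u ≠ v) : Function.update x v w u = x u := Function.update_of_ne hu _ _
    refine ⟨Function.update x v w, fun a ha b hb hab => ?_, fun T hT hc => ?_⟩
    · by_cases hav : a = v
      · subst hav
        rw [Function.update_self, hxu b hab.symm, ← hadj b (Finset.mem_erase.2 ⟨hab.symm, hb⟩),
          inner_eq_zero_symm]
      · by_cases hbv : b = v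
        · subst hbv
          rw [Function.update_self, hxu a hab, hadj a (Finset.mem_erase.2 ⟨hab, ha⟩), G.adj_comm]
        · rw [hxu a hav, hxu b hbv]
          exact hx a (Finset.mem_erase.2 ⟨hav, ha⟩) b (Finset.mem_erase.2 ⟨hbv, hb⟩) hab
    · have heq (T : Finset V) (hvT : v ∉ T) : Set.EqOn (Function.update x v w) x T :=
        fun u hu => hxu u (by rintro rfl; exact hvT hu)
      by_cases hvT : v ∈ T
      · rw [← Finset.insert_erase hvT, Finset.coe_insert, linearIndepOn_insert (by simp),
          Function.update_self, (heq _ (Finset.notMem_erase v T)).image_eq]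
        have hc' : (T.erase v).card + 1 = T.card := Finset.card_erase_add_one hvT
        refine ⟨?_, hwT _ ((Finset.erase_subset _ _).trans hT) (by omega)⟩
        exact (hind _ (Finset.erase_subset_erase _ hT) (by omega)).congr
          (heq _ (Finset.notMem_erase v T)).symm
      · exact (hind T (fun u hu => Finset.mem_erase.2 ⟨by rintro rfl; exact hvT hu, hT hu⟩)
          hc).congr (heq T hvT).symm

theorem msr_le {𝕜 : Type*} [RCLike 𝕜] [Fintype V] {G : SimpleGraph V} {A : Matrix V V 𝕜}
    (hA : A ∈ psdMatrices 𝕜 G) : msr 𝕜 G ≤ A.rank :=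
  Nat.sInf_le ⟨A, hA, rfl⟩

theorem IsDegenerate.msr_compl_le (𝕜 : Type*) [RCLike 𝕜] [Fintype V] {G : SimpleGraph V} {k : ℕ}
    (hG : G.IsDegenerate k) : msr 𝕜 Gᶜ ≤ 2 * k + 1 := by
  obtain ⟨d, hd⟩ : ∃ d, d = 2 * k + 1 := ⟨_, rfl⟩
  obtain ⟨x, hx, -⟩ := hG.exists_orthogonal_representation (𝕜 := 𝕜)
    (E := EuclideanSpace 𝕜 (Fin d)) (by simp [hd]) Finset.univ
  let M : Matrix (Fin d) V 𝕜 := Matrix.of fun i v => x v i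
  have hM (u v : V) : (M.conjTranspose * M) u v = inner 𝕜 (x u) (x v) := by
    simp [M, Matrix.mul_apply, PiLp.inner_apply, mul_comm]
  have hmem : M.conjTranspose * M ∈ psdMatrices 𝕜 Gᶜ := by
    refine ⟨Matrix.posSemidef_conjTranspose_mul_self M, fun i j hij => ?_⟩
    rw [hM, Ne, hx i (Finset.mem_univ i) j (Finset.mem_univ j) hij, compl_adj]
    simp [hij]
  rw [← hd]
  exact (msr_le hmem).trans ((Matrix.rank_mul_le_right _ _).trans ((Matrix.rank_le_card_height M).trans (by simp)))

end SimpleGraph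

/-! ### Real positive semidefinite matrices and rank -/

namespace Matrix

variable {n : Type*} [Fintype n]

/-- A ring homomorphism carries the rank normal form over K to one over L. This lets a real matrix
serve for both choices of 𝕜. -/
theorem rank_map_le {K L : Type*} [Field K] [Field L] (f : K →+* L) (A : Matrix n n K) :
    (A.map f).rank ≤ A.rank := by
  classical
  obtain ⟨P, Q, e, hP, hQ, h⟩ := A.exists_rank_normal_form
  let R : Matrix (Fin A.rank ⊕ Fin (Fintype.card n - A.rank)) (Fin A.rank) L := fromRows 1 0
  let C : Matrix (Fin A.rank) (Fin A.rank ⊕ Fin (Fintype.card n - A.rank)) L := fromCols 1 0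
  have hRC : R * C = fromBlocks 1 0 0 0 := by
    simp only [R, C, fromRows_mul_fromCols, Matrix.mul_one, Matrix.mul_zero]
  have hmap : P.map f * A.map f * Q.map f = (R * C).submatrix e e := by
    rw [← Matrix.map_mul, ← Matrix.map_mul, h, hRC]
    ext i j
    rcases hi : e i with a | a <;> rcases hj : e j with b | b <;>
      simp [hi, hj, Matrix.one_apply, apply_ite f]
  have hdet {B : Matrix n n K} (hB : IsUnit B) : IsUnit (B.map f).det :=
    (isUnit_iff_isUnit_det _).1 (hB.map f.mapMatrix)
  rw [← rank_mul_eq_right_of_isUnit_det _ _ (hdet hP),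
    ← rank_mul_eq_left_of_isUnit_det _ _ (hdet hQ), hmap, rank_submatrix]
  exact (rank_mul_le_left _ _).trans ((rank_le_card_width _).trans (by simp))

open scoped MatrixOrder in
theorem PosSemidef.map_ofReal (𝕜 : Type*) [RCLike 𝕜] {A : Matrix n n ℝ} (hA : A.PosSemidef) :
    (A.map (RCLike.ofReal : ℝ → 𝕜)).PosSemidef := by
  classical
  obtain ⟨B, rfl⟩ := CStarAlgebra.nonneg_iff_eq_star_mul_self.mp hA.nonneg
  have : (star B * B).map (RCLike.ofReal : ℝ → 𝕜) =
      (B.map (RCLike.ofReal : ℝ → 𝕜)).conjTranspose * B.map (RCLike.ofReal : ℝ → 𝕜) := by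
    ext i j
    simp [Matrix.mul_apply, star_eq_conjTranspose]
  rw [this]
  exact posSemidef_conjTranspose_mul_self _

theorem IsHermitian.exists_mulVec_eq {A : Matrix n n ℝ} (hA : A.IsHermitian) {b : n → ℝ}
    (hb : ∀ y, A *ᵥ y = 0 → b ⬝ᵥ y = 0) : ∃ x, A *ᵥ x = b := by
  classical
  have hs := isSymmetric_toEuclideanLin_iff.2 hA
  have hmem : WithLp.toLp 2 b ∈ (A.toEuclideanLin.range)ᗮᗮ := by
    rw [hs.orthogonal_range, Submodule.mem_orthogonal]
    intro y hy
    have hy' : A *ᵥ y.ofLp = 0 := by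
      have := congrArg WithLp.ofLp (LinearMap.mem_ker.1 hy)
      simpa using this
    simpa [EuclideanSpace.inner_eq_star_dotProduct] using hb _ hy'
  rw [Submodule.orthogonal_orthogonal] at hmem
  obtain ⟨x, hx⟩ := hmem
  exact ⟨x.ofLp, by simpa using congrArg WithLp.ofLp hx⟩

theorem rank_lt_of_ker {A B : Matrix n n ℝ} (h : ∀ y, A *ᵥ y = 0 → B *ᵥ y = 0) {x : n → ℝ}
    (hA : A *ᵥ x ≠ 0) (hB : B *ᵥ x = 0) : B.rank < A.rank := by
  have hlt : LinearMap.ker A.mulVecLin < LinearMap.ker B.mulVecLin := by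
    refine lt_of_le_of_ne (fun y hy => ?_) fun heq => ?_
    · simpa using h y (by simpa using hy)
    · have : x ∈ LinearMap.ker A.mulVecLin := heq ▸ (by simpa using hB)
      exact hA (by simpa using this)
  have h1 := LinearMap.finrank_range_add_finrank_ker A.mulVecLin
  have h2 := LinearMap.finrank_range_add_finrank_ker B.mulVecLin
  have h3 := Submodule.finrank_lt_finrank_of_lt hlt
  unfold rank
  omega

/-- Subtracting from a positive semidefinite matrix the critical multiple of `b bᵀ`, where
`b = A x`, keeps it positive semidefinite and adds `x` to its kernel. -/
theorem PosSemidef.sub_smul_vecMulVec {A : Matrix n n ℝ} (hA : A.PosSemidef) {b x : n → ℝ}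
    (hx : A *ᵥ x = b) (hb : b ≠ 0) :
    0 < b ⬝ᵥ x ∧ (A - (b ⬝ᵥ x)⁻¹ • vecMulVec b b).PosSemidef ∧
      (A - (b ⬝ᵥ x)⁻¹ • vecMulVec b b).rank < A.rank ∧
      ∀ y, (A - (b ⬝ᵥ x)⁻¹ • vecMulVec b b) *ᵥ y = 0 → ∃ a : ℝ, A *ᵥ (y - a • x) = 0 := by
  set c := b ⬝ᵥ x with hc
  have hcx : x ⬝ᵥ A *ᵥ x = c := by rw [hx, dotProduct_comm]
  have hAT : Aᵀ = A := conjTranspose_eq_transpose_of_trivial A ▸ hA.isHermitian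
  have hbA (y : n → ℝ) : x ⬝ᵥ A *ᵥ y = b ⬝ᵥ y := by
    rw [dotProduct_mulVec, ← mulVec_transpose, hAT, hx]
  have hpos : 0 < c := by
    refine lt_of_le_of_ne (by simpa [hcx] using hA.dotProduct_mulVec_nonneg x) fun h0 => hb ?_
    rw [← hx]
    exact (hA.dotProduct_mulVec_zero_iff x).1 (by simpa [hcx] using h0.symm)
  have hmul (y : n → ℝ) : (A - c⁻¹ • vecMulVec b b) *ᵥ y = A *ᵥ y - (c⁻¹ * (b ⬝ᵥ y)) • b := by
    rw [sub_mulVec, smul_mulVec, vecMulVec_mulVec]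
    ext i
    simp only [Pi.sub_apply, Pi.smul_apply, smul_eq_mul, MulOpposite.smul_eq_mul_unop,
      MulOpposite.unop_op]
    ring
  refine ⟨hpos, .of_dotProduct_mulVec_nonneg ?_ fun y => ?_, ?_, fun y hy => ?_⟩
  · refine hA.isHermitian.sub ?_
    ext i j
    simp [vecMulVec_apply, mul_comm]
  -- Completing the square: the new form at y is the form of A at this shifted vector.
  · have h := hA.dotProduct_mulVec_nonneg (y - (c⁻¹ * (b ⬝ᵥ y)) • x)
    rw [hmul]
    simp only [star_trivial, mulVec_sub, mulVec_smul, sub_dotProduct, dotProduct_sub, smul_dotProduct,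
      dotProduct_smul, hbA, hx, smul_eq_mul] at h ⊢
    rw [dotProduct_comm y b, dotProduct_comm x b, ← hc] at h
    rw [dotProduct_comm y b]
    have : c⁻¹ * c = 1 := inv_mul_cancel₀ hpos.ne'
    linear_combination h + (c⁻¹ * (b ⬝ᵥ y) ^ 2) * this
  · refine rank_lt_of_ker (fun y hy => ?_) (x := x) (by rwa [hx]) ?_
    · rw [hmul, ← hbA, hy]
      simp
    · rw [hmul, hx, ← hc, inv_mul_cancel₀ hpos.ne', one_smul, sub_self]
  · refine ⟨c⁻¹ * (b ⬝ᵥ y), ?_⟩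
    rw [mulVec_sub, mulVec_smul, hx, ← hmul, hy]

end Matrix

/-! ### Degeneracy of cactus graphs -/

namespace SimpleGraph

variable {V : Type*}

theorem IsCactus.toSubgraph_eq {G : SimpleGraph V} (hG : G.IsCactus) {u v : V} {p : G.Walk u u}
    {q : G.Walk v v} (hp : p.IsCycle) (hq : q.IsCycle) {e : Sym2 V} (hep : e ∈ p.edges)
    (heq : e ∈ q.edges) : p.toSubgraph = q.toSubgraph :=
  hG.2 e (p.edges_subset_edgeSet hep) ⟨⟨u, p, hp, rfl⟩, (p.mem_edges_toSubgraph).2 hep⟩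
    ⟨⟨v, q, hq, rfl⟩, (q.mem_edges_toSubgraph).2 heq⟩

-- The start v of a longest path inside S works. By maximality its neighbours in S lie on the path,
-- and each one other than `p.snd` closes a cycle through the first edge; only one such cycle
-- exists.
open Classical in
theorem IsCactus.isDegenerate_two [Finite V] {G : SimpleGraph V} (hG : G.IsCactus) :
    G.IsDegenerate 2 := by
  have := Fintype.ofFinite V
  intro S ⟨w, hw⟩
  let P : ℕ → Prop := fun m => ∃ (u v : V) (p : G.Walk u v), p.IsPath ∧
    (∀ a ∈ p.support, a ∈ S) ∧ p.length = m
  have hP0 : P 0 := ⟨w, w, .nil, .nil, by simpa using hw, rfl⟩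
  have hb (m : ℕ) (hm : P m) : m ≤ Fintype.card V := by
    obtain ⟨u, v, p, hp, -, rfl⟩ := hm
    exact hp.length_lt.le
  obtain ⟨v, t, p, hp, hpS, hlen⟩ : P (Nat.findGreatest P (Fintype.card V)) :=
    Nat.findGreatest_spec (Nat.zero_le _) hP0
  have hmax (m : ℕ) (hm : P m) : m ≤ p.length := hlen ▸ Nat.le_findGreatest (hb m hm) hm
  refine ⟨v, hpS v p.start_mem_support, ?_⟩
  have hsupp (a : V) (ha : a ∈ S) (hva : G.Adj v a) : a ∈ p.support := by
    by_contra hap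
    have := hmax (p.length + 1) ⟨a, t, .cons hva.symm p, hp.cons hap,
      by simpa [ha] using hpS, by simp⟩
    omega
  have hcyc (a : V) (hva : G.Adj v a) (hap : a ∈ p.support) (has : a ≠ p.snd) :
      (Walk.cons hva.symm (p.takeUntil a hap)).IsCycle := by
    refine (Walk.cons_isCycle_iff _ _).2 ⟨hp.takeUntil hap, fun h => has ?_⟩
    exact hp.eq_snd_of_mem_edges (p.edges_takeUntil_subset_edges hap (Sym2.eq_swap ▸ h))
  have huniq (a b : V) (hva : G.Adj v a) (hvb : G.Adj v b) (ha : a ∈ S) (hb : b ∈ S)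
      (has : a ≠ p.snd) (hbs : b ≠ p.snd) : a = b := by
    have hsnd (a : V) (hva : G.Adj v a) (hap : a ∈ p.support) :
        s(v, p.snd) ∈ (p.takeUntil a hap).edges := by
      have hnil : ¬ (p.takeUntil a hap).Nil := fun h => hva.ne h.eq
      have := Walk.mk_start_snd_mem_edges hnil
      rwa [Walk.snd_takeUntil hva.ne'] at this
    have hap := hsupp a ha hva
    have hbp := hsupp b hb hvb
    have heq := hG.toSubgraph_eq (hcyc a hva hap has) (hcyc b hvb hbp hbs) (e := s(v, p.snd))
      (by simp [hsnd a hva hap]) (by simp [hsnd b hvb hbp])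
    -- The cycles closed by a and b coincide, and the only edges at v in the latter lead to b and
    -- `p.snd`.
    have hmem : s(a, v) ∈ (Walk.cons hvb.symm (p.takeUntil b hbp)).edges := by
      rw [← Walk.mem_edges_toSubgraph, ← heq, Walk.mem_edges_toSubgraph]
      simp
    rw [Walk.edges_cons, List.mem_cons] at hmem
    rcases hmem with h | h
    · simpa [hva.ne', hvb.ne'] using h
    · exact (has (hp.eq_snd_of_mem_edges
        (p.edges_takeUntil_subset_edges hbp (Sym2.eq_swap ▸ h)))).elim
  have hrest : ((S.filter (G.Adj v)).erase p.snd).card ≤ 1 := by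
    refine Finset.card_le_one.2 fun a ha b hb => ?_
    simp only [Finset.mem_erase, Finset.mem_filter] at ha hb
    exact huniq a b ha.2.2 hb.2.2 ha.2.1 hb.2.1 ha.1 hb.1
  have := Finset.pred_card_le_card_erase (s := S.filter (G.Adj v)) (a := p.snd)
  omega

theorem Walk.apply_eq_of_forall_mem_edges {G : SimpleGraph V} {α : Type*} {x : V → α} {u v : V}
    (p : G.Walk u v) (h : ∀ a b, s(a, b) ∈ p.edges → x a = x b) : x u = x v := by
  induction p with
  | nil => rfl
  | cons _ p ih =>
    exact (h _ _ (by simp)).trans (ih fun a b hab => h a b (by simp [hab]))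

/-! ### Restoring edges and electrical potentials -/

open Matrix

theorem deleteEdges_sup_edge {G : SimpleGraph V} {s t : V} (h : G.Adj s t) :
    G.deleteEdges {s(s, t)} ⊔ edge s t = G := by
  ext a b
  have := h.symm
  have := h.ne
  simp only [sup_adj, deleteEdges_adj, edge_adj, Set.mem_singleton_iff, Sym2.eq_iff]
  constructor
  · rintro (h | ⟨⟨rfl, rfl⟩ | ⟨rfl, rfl⟩, -⟩) <;> tauto
  · intro hab
    have := hab.ne
    tauto

/-- Off the diagonal b bᵀ is supported on the pair st, where A vanishes, so the subtraction creates
just this edge. The last clause controls the kernel for a further restoration. -/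
theorem exists_mem_psdMatrices_sup_edge [Fintype V] [DecidableEq V] {H : SimpleGraph V}
    {A : Matrix V V ℝ} (hA : A ∈ psdMatrices ℝ H) {s t : V} (hst : s ≠ t) (hadj : ¬ H.Adj s t)
    (hker : ∀ y, A *ᵥ y = 0 → y s = y t) :
    ∃ x, A *ᵥ x = Pi.single s 1 - Pi.single t 1 ∧ ∃ B ∈ psdMatrices ℝ (H ⊔ edge s t),
      B.rank < A.rank ∧ ∀ y, B *ᵥ y = 0 → ∃ a : ℝ, A *ᵥ (y - a • x) = 0 := by
  obtain ⟨hpsd, hAG⟩ := hA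
  set b : V → ℝ := Pi.single s 1 - Pi.single t 1 with hb
  have hb0 : b ≠ 0 := fun h => by simpa [hb, hst] using congrFun h s
  obtain ⟨x, hx⟩ := hpsd.isHermitian.exists_mulVec_eq (b := b) fun y hy => by
    simp [hb, sub_dotProduct, hker y hy]
  obtain ⟨hpos, hB, hrank, hBker⟩ := hpsd.sub_smul_vecMulVec hx hb0
  refine ⟨x, hx, _, ⟨hB, fun i j hij => ?_⟩, hrank, hBker⟩
  have hbij : b i * b j ≠ 0 ↔ (i = s ∧ j = t ∨ i = t ∧ j = s) := by
    simp only [hb, Pi.sub_apply, Pi.single_apply]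
    split_ifs <;> simp_all
  rw [sup_adj, edge_adj, ← hAG i j hij, ← hbij]
  simp only [Matrix.sub_apply, Matrix.smul_apply, vecMulVec_apply, smul_eq_mul]
  by_cases h : b i * b j = 0
  · simp [h]
  · have hAij : A i j = 0 := by
      refine not_not.1 (mt (hAG i j hij).1 ?_)
      rcases hbij.1 h with ⟨rfl, rfl⟩ | ⟨rfl, rfl⟩
      · exact hadj
      · exact fun h' => hadj h'.symm
    simp [hAij, h, hpos.ne', hij]

theorem lapMatrix_mem_psdMatrices [Fintype V] [DecidableEq V] (G : SimpleGraph V)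
    [DecidableRel G.Adj] : G.lapMatrix ℝ ∈ psdMatrices ℝ G := by
  refine ⟨posSemidef_lapMatrix ℝ G, fun i j hij => ?_⟩
  simp [lapMatrix, degMatrix, hij, adjMatrix_apply]

-- The indicator of one side of a bridge changes along no other edge.
open Classical in
theorem lapMatrix_mulVec_reachable_deleteEdges [Fintype V] {G : SimpleGraph V}
    {a b : V} (hab : G.Adj a b) (hbr : G.IsBridge s(a, b)) :
    (G.lapMatrix ℝ *ᵥ fun v => if (G.deleteEdges {s(a, b)}).Reachable a v then 1 else 0) =
      Pi.single a 1 - Pi.single b 1 := by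
  rw [isBridge_iff] at hbr
  set K := G.deleteEdges {s(a, b)} with hK
  ext v
  set χ : V → ℝ := fun v => if K.Reachable a v then 1 else 0 with hχ
  have h1 : (G.lapMatrix ℝ *ᵥ χ) v = ∑ u, if G.Adj v u then χ v - χ u else 0 := by
    rw [lapMatrix_mulVec_apply, degree_eq_sum_if_adj, Finset.sum_mul, neighborFinset_eq_filter,
      Finset.sum_filter, ← Finset.sum_sub_distrib]
    refine Finset.sum_congr rfl fun u _ => ?_
    split_ifs <;> simp
  have h2 (u : V) : (if G.Adj v u then χ v - χ u else 0) =
      (if u = b then (if v = a then 1 else 0) else 0) -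
        (if u = a then (if v = b then 1 else 0) else 0) := by
    have hne := hab.ne
    have hχa : χ a = 1 := by simp [hχ]
    have hχb : χ b = 0 := by simp [hχ, hbr]
    by_cases h : s(v, u) = s(a, b)
    · rcases Sym2.eq_iff.1 h with ⟨rfl, rfl⟩ | ⟨rfl, rfl⟩
      · simp [hab, hχa, hχb, hne.symm]
      · simp [hab.symm, hχa, hχb, hne]
    · have h3 : (if G.Adj v u then χ v - χ u else 0) = 0 := by
        split_ifs with hvu
        · have hKvu : K.Adj v u := by simpa [hK, hvu] using h
          have : K.Reachable a v ↔ K.Reachable a u :=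
            ⟨fun h => h.trans hKvu.reachable, fun h => h.trans hKvu.symm.reachable⟩
          simp [hχ, this]
        · rfl
      rw [h3]
      simp only [Sym2.eq_iff, not_or, not_and] at h
      split_ifs <;> simp_all
  rw [h1, Finset.sum_congr rfl fun u _ => h2 u, Finset.sum_sub_distrib]
  simp [Pi.single_apply]

-- No current crosses a bridge with source and sink on the same side: pair the equation for x with
-- the indicator of that bridge's side and use symmetry of the Laplacian.
open Classical in
theorem eq_of_lapMatrix_mulVec_eq [Fintype V] {G : SimpleGraph V} {a b s t : V}
    (hab : G.Adj a b) (hbr : G.IsBridge s(a, b))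
    (hst : (G.deleteEdges {s(a, b)}).Reachable s t) {x : V → ℝ}
    (hx : G.lapMatrix ℝ *ᵥ x = Pi.single s 1 - Pi.single t 1) : x a = x b := by
  have h := lapMatrix_mulVec_reachable_deleteEdges hab hbr
  set χ : V → ℝ := fun v => if (G.deleteEdges {s(a, b)}).Reachable a v then 1 else 0 with hχ
  have hχst : χ s = χ t := by
    have : (G.deleteEdges {s(a, b)}).Reachable a s ↔ (G.deleteEdges {s(a, b)}).Reachable a t :=
      ⟨fun h => h.trans hst, fun h => h.trans hst.symm⟩
    simp [hχ, this]
  have h1 : (G.lapMatrix ℝ *ᵥ χ) ⬝ᵥ x = χ ⬝ᵥ (G.lapMatrix ℝ *ᵥ x) := by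
    rw [dotProduct_mulVec, ← mulVec_transpose, (G.isSymm_lapMatrix ℝ).eq]
  rw [h, hx] at h1
  simp only [sub_dotProduct, dotProduct_sub, single_dotProduct, dotProduct_single, one_mul,
    mul_one, hχst, sub_self] at h1
  linarith

theorem IsCactus.msr_add_three_le (𝕜 : Type*) [RCLike 𝕜] [Fintype V] {G : SimpleGraph V}
    (hG : G.IsCactus) (hcyc : G.HasTwoCycles) : msr 𝕜 G + 3 ≤ Fintype.card V := by
  classical
  obtain ⟨_, ⟨s₁, p, hp, rfl⟩, _, ⟨s₂, q, hq, rfl⟩, hpq⟩ := hcyc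
  have hdisj (e : Sym2 V) (hep : e ∈ p.edges) : e ∉ q.edges :=
    fun heq => hpq (hG.toSubgraph_eq hp hq hep heq)
  cases p with
  | nil => exact absurd hp (by simp)
  | @cons _ t₁ _ h₁ p =>
  cases q with
  | nil => exact absurd hq (by simp)
  | @cons _ t₂ _ h₂ q =>
  have hp1 := ((Walk.cons_isCycle_iff _ _).1 hp).2
  have hq2 := ((Walk.cons_isCycle_iff _ _).1 hq).2
  have hp2 : s(s₂, t₂) ∉ p.edges := fun h => hdisj s(s₂, t₂) (by simp [h]) (by simp)
  have h12 : s(s₁, t₁) ≠ s(s₂, t₂) := fun h => hdisj s(s₁, t₁) (by simp) (by simp [h])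
  set H := G.deleteEdges {s(s₂, t₂)} with hH
  set F := H.deleteEdges {s(s₁, t₁)} with hF
  have hpF (e : Sym2 V) (he : e ∈ p.edges) : e ∈ F.edgeSet := by
    simp only [hF, hH, edgeSet_deleteEdges, Set.mem_sdiff, Set.mem_singleton_iff]
    exact ⟨⟨p.edges_subset_edgeSet he, by rintro rfl; exact hp2 he⟩, by rintro rfl; exact hp1 he⟩
  have hHadj : H.Adj s₁ t₁ := by simpa [hH, h₁] using h12
  have hHconn : H.Connected := by
    refine hG.1.connected_delete_edge_of_not_isBridge fun h => isBridge_iff.1 h ?_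
    exact ⟨(q.toDeleteEdges _ fun e he => by rintro rfl; exact hq2 he).reverse⟩
  have hFconn : F.Connected :=
    hHconn.connected_delete_edge_of_not_isBridge fun h =>
      isBridge_iff.1 h ⟨(p.transfer F hpF).reverse⟩
  -- A cycle of H through an edge of q would be the second cycle of G, which uses the removed edge
  -- s₂t₂.
  have hbr (e : Sym2 V) (he : e ∈ q.edges) : H.IsBridge e := by
    have heH : e ∈ H.edgeSet := by
      simp only [hH, edgeSet_deleteEdges, Set.mem_sdiff, Set.mem_singleton_iff]
      exact ⟨q.edges_subset_edgeSet he, by rintro rfl; exact hq2 he⟩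
    refine (isBridge_iff_forall_cycle_notMem heH).2 fun u r hr her => ?_
    have hrG (e) (he : e ∈ r.edges) : e ∈ G.edgeSet :=
      edgeSet_mono (deleteEdges_le _) (r.edges_subset_edgeSet he)
    have heq := hG.toSubgraph_eq (hr.transfer hrG) hq (e := e) (by simpa using her) (by simp [he])
    have hmem : s(s₂, t₂) ∈ (r.transfer G hrG).edges := by
      rw [← Walk.mem_edges_toSubgraph, heq, Walk.mem_edges_toSubgraph]
      simp
    rw [Walk.edges_transfer] at hmem
    simpa [hH] using r.edges_subset_edgeSet hmem
  obtain ⟨x, hx, B, hB, hBrank, hBker⟩ := exists_mem_psdMatrices_sup_edge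
    F.lapMatrix_mem_psdMatrices h₁.ne (by simp [hF])
    fun y hy => (F.lapMatrix_mulVec_eq_zero_iff_forall_reachable).1 hy _ _ (hFconn.1 _ _)
  rw [deleteEdges_sup_edge hHadj] at hB
  -- For each edge of q, the path p avoids it and so still joins s₁ to t₁ once it is deleted.
  have hxq : x t₂ = x s₂ := by
    have hstep (a b : V) (hab : s(a, b) ∈ q.edges) : x a = x b := by
      have habF : F.Adj a b := by
        simp only [hF, hH, deleteEdges_adj, Set.mem_singleton_iff]
        exact ⟨⟨q.adj_of_mem_edges hab, fun h => hq2 (h ▸ hab)⟩,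
          fun h => hdisj s(s₁, t₁) (by simp) (by simp [← h, hab])⟩
      refine eq_of_lapMatrix_mulVec_eq habF
        (fun h => hbr _ hab (h.mono (deleteEdges_mono (deleteEdges_le _)))) ?_ (by convert hx)
      refine ⟨(p.transfer _ fun e he => ?_).reverse⟩
      rw [edgeSet_deleteEdges]
      exact ⟨hpF e he, by rintro rfl; exact hdisj s(a, b) (by simp [he]) (by simp [hab])⟩
    exact q.apply_eq_of_forall_mem_edges hstep
  -- A kernel vector of B is a constant plus a multiple of x, hence equal at s₂ and t₂.
  obtain ⟨-, -, C, hC, hCrank, -⟩ := exists_mem_psdMatrices_sup_edge hB h₂.ne (by simp [hH])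
    fun y hy => by
      obtain ⟨a, ha⟩ := hBker y hy
      have := (F.lapMatrix_mulVec_eq_zero_iff_forall_reachable).1 ha s₂ t₂ (hFconn.1 _ _)
      simpa [hxq] using this
  rw [deleteEdges_sup_edge h₂] at hC
  have hL : (F.lapMatrix ℝ).rank < (1 : Matrix V V ℝ).rank :=
    rank_lt_of_ker (by simp) (x := fun _ => 1)
      (fun h => by simpa using congrFun h s₁) F.lapMatrix_mulVec_const_eq_zero
  rw [rank_one] at hL
  have hmem : C.map (RCLike.ofReal : ℝ → 𝕜) ∈ psdMatrices 𝕜 G :=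
    ⟨hC.1.map_ofReal 𝕜, fun i j hij => by simpa using hC.2 i j hij⟩
  have hr : (C.map (RCLike.ofReal : ℝ → 𝕜)).rank ≤ C.rank := rank_map_le (algebraMap ℝ 𝕜) C
  have := msr_le hmem
  omega

end SimpleGraph

theorem proposition4p6 (𝕜 : Type*) [RCLike 𝕜] {V : Type*} [Fintype V] (G : SimpleGraph V)
    (hG : G.IsCactus) (hcyc : G.HasTwoCycles) : G.SatisfiesGCCPlus 𝕜 := by
  have h₁ := hG.msr_add_three_le 𝕜 hcyc
  have h₂ := hG.isDegenerate_two.msr_compl_le 𝕜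
  unfold SimpleGraph.SatisfiesGCCPlus
  omega
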